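/- Let $G$ be a finite graph, regarded as a topological space (the geometric realization of a graph with finitely many vertices and edges), and let $X$ be a nondegenerate continuum, i.e. a compact connected metric space with more than one point. Assume that $X$ is $G$-like: for every $\varepsilon>0$ there is a continuous map $g$ from $X$ onto $G$ such that $\operatorname{diam} g^{-1}(y)<\varepsilon$ for every $y\in G$. Let $h:X\to X$ be a homeomorphism with uniformly positive entropy (u.p.e.), in the following sense: for all $x_1,x_2\in X$ and all open sets $A_1\ni x_1$, $A_2\ni x_2$ there is a set $I\subseteq\mathbb N$ of positive density (the limit $\lim_{n\to\infty}|I\cap[1,n]|/n$ exists and is positive) such that $\bigcap_{j\in J}h^{-j}(Y_j)\neq\emptyset$ for every finite $J\subseteq I$ and every choice of $Y_j\in\{A_1,A_2\}$, $j\in J$. Then $X$ is an indecomposable continuum, that is, $X$ is a continuum with more than one point that is not the union of two proper subcontinua. -/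

import Mathlib

open Filter Topology

/-- The geometric realization of a simple graph on a finite vertex set `V`, as a subspace of
`V → ℝ`: all points in barycentric coordinates
whose support is contained in a single vertex or in the two endpoints of a single edge. -/
def graphRealization {V : Type*} [Fintype V] (Γ : SimpleGraph V) : Set (V → ℝ) :=
  {x | x ∈ stdSimplex ℝ V ∧
    ∃ u v : V, (u = v ∨ Γ.Adj u v) ∧ ∀ w : V, x w ≠ 0 → w = u ∨ w = v}

/-- A topological space is a finite (topological) graph if it is homeomorphic to the geometric
realization of a simple graph with finitely many vertices. Loops and multiple edges are covered,
since they can be subdivided without changing the space. -/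
def IsFiniteTopGraph (G : Type*) [TopologicalSpace G] : Prop :=
  ∃ (n : ℕ) (Γ : SimpleGraph (Fin n)), Nonempty (G ≃ₜ graphRealization Γ)

/-- A continuous surjection `g : X → G` all of whose fibres have diameter less than `ε`.
The space `X` is compact, so that every fibre is bounded and `Metric.diam` is its diameter. -/
def IsEpsMapping {X G : Type*} [MetricSpace X] [CompactSpace X] [TopologicalSpace G]
    (ε : ℝ) (g : X → G) : Prop :=
  Continuous g ∧ Function.Surjective g ∧ ∀ y : G, Metric.diam (g ⁻¹' {y}) < ε

/-- `X` is `G`-like: for every `ε > 0` there is an `ε`-mapping from `X` onto `G`. -/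
def IsLike (X G : Type*) [MetricSpace X] [CompactSpace X] [TopologicalSpace G] : Prop :=
  ∀ ε : ℝ, 0 < ε → ∃ g : X → G, IsEpsMapping ε g

/-- A set of natural numbers has positive density: the limit of `|I ∩ [1,n]| / n` exists and is
positive. -/
def HasPositiveDensity (I : Set ℕ) : Prop :=
  ∃ d : ℝ, 0 < d ∧
    Tendsto (fun n : ℕ => ((I ∩ Set.Icc 1 n).ncard : ℝ) / (n : ℝ)) atTop (𝓝 d)

/-- The collection `𝒜` of subsets of `X` has an independence set of positive density for `f`. -/
def HasISPD {X : Type*} (f : X → X) (𝒜 : Set (Set X)) : Prop :=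
  ∃ I : Set ℕ, HasPositiveDensity I ∧
    ∀ J : Finset ℕ, (J : Set ℕ) ⊆ I → ∀ Y : ℕ → Set X, (∀ j ∈ J, Y j ∈ 𝒜) →
      (⋂ j ∈ J, f^[j] ⁻¹' (Y j)).Nonempty

/-- `(x₁, …, xₖ)` is an IE-tuple for `f`. -/
def IsIETuple {X : Type*} [TopologicalSpace X] (f : X → X) {k : ℕ} (x : Fin k → X) : Prop :=
  ∀ A : Fin k → Set X, (∀ i, IsOpen (A i) ∧ x i ∈ A i) → HasISPD f (Set.range A)

/-- Uniformly positive entropy (u.p.e.): every pair of points is an IE-pair. -/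
def HasUPE {X : Type*} [TopologicalSpace X] (f : X → X) : Prop :=
  ∀ x : Fin 2 → X, IsIETuple f x

/-- A subset of a metric space that is a continuum (compact, connected and nonempty). -/
def IsSubcontinuum {X : Type*} [MetricSpace X] (H : Set X) : Prop :=
  IsCompact H ∧ IsConnected H

/-- `X` is an indecomposable continuum: a continuum with more than one point that is not the union
of two proper subcontinua. -/
def IsIndecomposableContinuum (X : Type*) [MetricSpace X] : Prop :=
  CompactSpace X ∧ ConnectedSpace X ∧ Nontrivial X ∧
    ¬ ∃ H K : Set X, IsSubcontinuum H ∧ IsSubcontinuum K ∧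
      H ≠ Set.univ ∧ K ≠ Set.univ ∧ H ∪ K = Set.univ

/-! If `X = H ∪ K` with `H`, `K` proper, then `Kᶜ ⊆ H` and `Hᶜ` are nonempty and open, so u.p.e.
makes them independent along an infinite set of times. Assigning one time to each subset of `Fin k`
gives `k` points whose subsets are all cut out by preimages of `H` under iterates of `h`
(`HasISPD.exists_shattered`). These preimages are connected, as `h` is a homeomorphism, and an
`ε`-mapping with small `ε` carries the pattern to `G`. But connected subsets of `G` have bounded
shattering power: among enough points four lie on one edge, and no connected set picks out just the
first and third of them. -/

/-- A connected subset of a graph meets an edge in an order convex set, up to the two ends: it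
cannot contain the first and the third, and miss the second and the fourth, of four points which
lie in this order on the edge with end points `u` and `v`. -/
theorem not_alternating_on_edge {V : Type*} [Fintype V] {Γ : SimpleGraph V}
    {C : Set (V → ℝ)} (hC : IsPreconnected C) (hCΓ : C ⊆ graphRealization Γ) {u v : V}
    {p : Fin 4 → V → ℝ} (hp : ∀ i, p i ∈ stdSimplex ℝ V)
    (hsupp : ∀ i w, p i w ≠ 0 → w = u ∨ w = v) (hmono : Monotone fun i => p i u)
    (h0 : p 0 ∈ C) (h1 : p 1 ∉ C) (h2 : p 2 ∈ C) (h3 : p 3 ∉ C) : False := by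
  classical
  have sum_eq : ∀ x ∈ stdSimplex ℝ V, (∀ w, x w ≠ 0 → w = u ∨ w = v) → u ≠ v →
      x u + x v = 1 := by
    intro x hx hs huv
    rw [← hx.2, ← Finset.sum_pair huv]
    refine Finset.sum_subset (Finset.subset_univ _) fun w _ hw => ?_
    by_contra hne
    exact hw (by simpa using hs w hne)
  have eq_of : ∀ x ∈ stdSimplex ℝ V, (∀ w, x w ≠ 0 → w = u ∨ w = v) →
      ∀ y ∈ stdSimplex ℝ V, (∀ w, y w ≠ 0 → w = u ∨ w = v) → x u = y u → x = y := by
    intro x hx hxs y hy hys hxy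
    funext w
    by_cases hwu : w = u
    · rw [hwu, hxy]
    by_cases hwv : w = v
    · have huv : u ≠ v := fun h => hwu (hwv.trans h.symm)
      rw [hwv]
      linarith [sum_eq x hx hxs huv, sum_eq y hy hys huv]
    · have hxw : x w = 0 := by_contra fun h => (hxs w h).elim hwu hwv
      have hyw : y w = 0 := by_contra fun h => (hys w h).elim hwu hwv
      rw [hxw, hyw]
  -- Monotonicity allows ties; membership in `C` tells neighbours apart, which makes the order
  -- strict.
  have lt_of : ∀ i j : Fin 4, i ≤ j → p i ≠ p j → p i u < p j u := fun i j hij hne =>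
    lt_of_le_of_ne (hmono hij) fun h => hne (eq_of _ (hp i) (hsupp i) _ (hp j) (hsupp j) h)
  have h01 := lt_of 0 1 (by decide) fun h => h1 (h ▸ h0)
  have h12 := lt_of 1 2 (by decide) fun h => h1 (h ▸ h2)
  have h23 := lt_of 2 3 (by decide) fun h => h3 (h ▸ h2)
  have huv : u ≠ v := by
    rintro rfl
    have key : ∀ i, p i u = 1 := fun i => by
      rw [← (hp i).2]
      exact (Finset.sum_eq_single u
        (fun w _ hw => by_contra fun h => hw (by simpa using hsupp i w h)) (by simp)).symm
    linarith [key 0, key 1]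
  have hsum3 := sum_eq _ (hp 3) (hsupp 3) huv
  have h3v := (hp 3).1 v
  have h1u := (hp 1).1 u
  -- On the graph, `U` is the open arc from `p 1` to `p 3` and `W` is the complement of the closed
  -- arc. As `C` misses both ends, they would disconnect it.
  let U : Set (V → ℝ) := {x | p 1 u < x u ∧ x u < p 3 u ∧ 0 < x v}
  let W : Set (V → ℝ) := {x | x u < p 1 u} ∪ {x | p 3 u < x u} ∪
    ⋃ w ∈ {w | w ≠ u ∧ w ≠ v}, {x | x w ≠ 0}
  have hU : IsOpen U :=
    (isOpen_lt continuous_const (continuous_apply u)).inter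
      ((isOpen_lt (continuous_apply u) continuous_const).inter
        (isOpen_lt continuous_const (continuous_apply v)))
  have hW : IsOpen W :=
    ((isOpen_lt (continuous_apply u) continuous_const).union
      (isOpen_lt continuous_const (continuous_apply u))).union
      (isOpen_biUnion fun w _ => isOpen_ne_fun (continuous_apply w) continuous_const)
  have hcover : C ⊆ U ∪ W := by
    intro x hx
    by_cases hxW : x ∈ W
    · exact Or.inr hxW
    simp only [W, Set.mem_union, Set.mem_ofPred_eq, Set.mem_iUnion, not_or, not_exists,
      not_lt, not_not] at hxW
    obtain ⟨⟨ha, hb⟩, hc⟩ := hxW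
    have hxs : ∀ w, x w ≠ 0 → w = u ∨ w = v := fun w hw =>
      by_contra fun h => hw (hc w (not_or.1 h))
    have hxΔ := (hCΓ hx).1
    have ha' : p 1 u < x u := lt_of_le_of_ne ha fun h =>
      h1 (eq_of _ (hp 1) (hsupp 1) x hxΔ hxs h ▸ hx)
    have hb' : x u < p 3 u := lt_of_le_of_ne hb fun h =>
      h3 (eq_of x hxΔ hxs _ (hp 3) (hsupp 3) h ▸ hx)
    exact Or.inl ⟨ha', hb', by linarith [sum_eq x hxΔ hxs huv]⟩
  have hp2 : p 2 ∈ U := ⟨h12, h23, by linarith [sum_eq _ (hp 2) (hsupp 2) huv]⟩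
  obtain ⟨x, hxC, ⟨hxa, hxb, hxv⟩, hxW⟩ :=
    hC U W hU hW hcover ⟨p 2, h2, hp2⟩ ⟨p 0, h0, Or.inl (Or.inl h01)⟩
  simp only [W, Set.mem_union, Set.mem_ofPred_eq, Set.mem_iUnion] at hxW
  rcases hxW with (hlt | hlt) | ⟨w, ⟨hwu, hwv⟩, hw⟩
  · exact lt_asymm hxa hlt
  · exact lt_asymm hxb hlt
  -- Three distinct vertices cannot all lie in `{a, b}`.
  · obtain ⟨-, a, b, -, hab⟩ := hCΓ hxC
    have hu := hab u (by linarith)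
    have hv := hab v hxv.ne'
    have hw' := hab w hw
    clear * - hu hv hw' huv hwu hwv
    grind

/-- Connected subsets of a finite graph cannot shatter arbitrarily large finite sets. -/
theorem exists_card_not_shattered_by_connected {G : Type*} [TopologicalSpace G]
    (hG : IsFiniteTopGraph G) :
    ∃ k : ℕ, ∀ (w : Fin k → G) (C : Finset (Fin k) → Set G), (∀ S, IsPreconnected (C S)) →
      ¬ ∀ S i, w i ∈ C S ↔ i ∈ S := by
  classical
  obtain ⟨n, Γ, ⟨φ⟩⟩ := hG
  -- Pigeonhole: with `n * n` endpoint pairs, some pair serves more than three points.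
  refine ⟨n * n * 3 + 1, fun w C hC hw => ?_⟩
  have hedge : ∀ i, ∃ e : Fin n × Fin n, ∀ a, (φ (w i)).1 a ≠ 0 → a = e.1 ∨ a = e.2 := by
    intro i
    obtain ⟨-, a, b, -, hab⟩ := (φ (w i)).2
    exact ⟨(a, b), hab⟩
  choose e he using hedge
  obtain ⟨⟨u, v⟩, huv⟩ := Fintype.exists_lt_card_fiber_of_mul_lt_card (n := 3) e (by simp)
  obtain ⟨T, hT, hTcard⟩ := Finset.exists_subset_card_eq (Nat.succ_le_of_lt huv)
  let f : Fin 4 → Fin (n * n * 3 + 1) := T.orderEmbOfFin hTcard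
  have hf : Function.Injective f := (T.orderEmbOfFin hTcard).injective
  have hfe : ∀ i, e (f i) = (u, v) := fun i => by
    simpa using hT (T.orderEmbOfFin_mem hTcard i)
  let q : Fin 4 → ℝ := fun i => (φ (w (f i))).1 u
  let τ := Tuple.sort q
  have hfτ : Function.Injective (f ∘ τ) := hf.comp τ.injective
  let S : Finset (Fin (n * n * 3 + 1)) := {f (τ 0), f (τ 2)}
  have hconn : IsPreconnected ((fun x => (φ x).1) '' C S) :=
    (hC S).image _ (continuous_subtype_val.comp φ.continuous).continuousOn
  have hmem : ∀ i, (φ (w i)).1 ∈ (fun x => (φ x).1) '' C S ↔ i ∈ S := by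
    intro i
    rw [← hw S i]
    exact (Subtype.val_injective.comp φ.injective).mem_set_image
  have hne : ∀ i j, i ≠ j → f (τ i) ≠ f (τ j) := fun i j hij h => hij (hfτ h)
  refine not_alternating_on_edge (Γ := Γ) hconn ?_ (u := u) (v := v)
    (p := fun i => (φ (w (f (τ i)))).1) (fun i => (φ (w (f (τ i)))).2.1) ?_
    (Tuple.monotone_sort q) ((hmem _).2 ?_) (fun h => ?_) ((hmem _).2 ?_) (fun h => ?_)
  · rintro _ ⟨x, -, rfl⟩
    exact (φ x).2
  · intro i a ha
    simpa [hfe] using he (f (τ i)) a ha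
  · simp [S]
  · have h' := (hmem _).1 h
    simp only [S, Finset.mem_insert, Finset.mem_singleton] at h'
    exact h'.elim (hne 1 0 (by decide)) (hne 1 2 (by decide))
  · simp [S]
  · have h' := (hmem _).1 h
    simp only [S, Finset.mem_insert, Finset.mem_singleton] at h'
    exact h'.elim (hne 3 0 (by decide)) (hne 3 2 (by decide))

/-- A finite set has density zero. Infinitude is all that the argument needs from positive density.
-/
theorem HasPositiveDensity.infinite {I : Set ℕ} (hI : HasPositiveDensity I) : I.Infinite := by
  intro hfin
  obtain ⟨d, hd, hlim⟩ := hI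
  refine hd.ne' (tendsto_nhds_unique hlim ?_)
  refine squeeze_zero (fun n => by positivity) (fun n => ?_)
    (tendsto_const_div_atTop_nhds_zero_nat (I.ncard : ℝ))
  gcongr
  exact Set.inter_subset_left

/-- Finitely many pairs of a point and a compact set not containing it remain separated under
any `ε`-mapping with `ε` small enough. -/
theorem exists_pos_forall_isEpsMapping_notMem_image {X : Type*} [MetricSpace X] [CompactSpace X]
    {ι : Type*} [Finite ι] (z : ι → X) (H : ι → Set X) (hH : ∀ i, IsClosed (H i)) :
    ∃ ε : ℝ, 0 < ε ∧ ∀ {G : Type*} [TopologicalSpace G] (g : X → G), IsEpsMapping ε g →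
      ∀ i, z i ∉ H i → g (z i) ∉ g '' H i := by
  have hpos : ∀ i, ∃ δ : ℝ, 0 < δ ∧ (z i ∉ H i → ∀ y ∈ H i, δ ≤ dist y (z i)) := by
    intro i
    by_cases hz : z i ∈ H i
    · exact ⟨1, one_pos, fun h => absurd hz h⟩
    · obtain ⟨δ, hδ, hball⟩ := Metric.isOpen_iff.1 (hH i).isOpen_compl (z i) hz
      exact ⟨δ, hδ, fun _ y hy => not_lt.1 fun hlt => hball hlt hy⟩
  choose δ hδ hsep using hpos
  obtain ⟨ε, hε, hle⟩ : ∃ ε : ℝ, 0 < ε ∧ ∀ i, ε ≤ δ i := by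
    cases isEmpty_or_nonempty ι
    · exact ⟨1, one_pos, fun i => isEmptyElim i⟩
    · obtain ⟨i₀, hi₀⟩ := Finite.exists_min δ
      exact ⟨δ i₀, hδ i₀, hi₀⟩
  refine ⟨ε, hε, fun g hg i hz => ?_⟩
  rintro ⟨y, hy, hyz⟩
  have hdist : dist y (z i) ≤ Metric.diam (g ⁻¹' {g (z i)}) :=
    Metric.dist_le_diam_of_mem Metric.isBounded_of_compactSpace hyz rfl
  linarith [hg.2.2 (g (z i)), hle i, hsep i hz y hy]

/-- Along an independence set of positive density, the preimages of the two sets cut out every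
pattern on `k` suitable points. -/
theorem HasISPD.exists_shattered {X : Type*} {f : X → X} {A B : Set X}
    (hAB : HasISPD f {A, B}) (k : ℕ) :
    ∃ (z : Fin k → X) (t : Finset (Fin k) → ℕ), ∀ S i,
      (i ∈ S → f^[t S] (z i) ∈ A) ∧ (i ∉ S → f^[t S] (z i) ∈ B) := by
  classical
  obtain ⟨I, hI, hind⟩ := hAB
  let t : Finset (Fin k) → ℕ := fun S => hI.infinite.natEmbedding I (Encodable.encode S)
  have ht : Function.Injective t := Subtype.val_injective.comp
    ((hI.infinite.natEmbedding I).injective.comp Encodable.encode_injective)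
  have hz : ∀ i : Fin k, ∃ x, ∀ S, f^[t S] x ∈ if i ∈ S then A else B := by
    intro i
    obtain ⟨x, hx⟩ := hind (Finset.univ.image t)
      (by
        intro j hj
        obtain ⟨S, -, rfl⟩ := Finset.mem_image.1 hj
        exact (hI.infinite.natEmbedding I (Encodable.encode S)).2)
      -- The pattern must be indexed by times; injectivity of `t` recovers `S` from `j = t S`.
      (fun j => if ∃ S, t S = j ∧ i ∈ S then A else B)
      (fun j _ => by split_ifs <;> simp)
    refine ⟨x, fun S => ?_⟩
    have hxS := Set.mem_iInter₂.1 hx (t S) (Finset.mem_image_of_mem t (Finset.mem_univ S))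
    have hiff : (∃ S', t S' = t S ∧ i ∈ S') ↔ i ∈ S :=
      ⟨fun ⟨S', hS', hi⟩ => ht hS' ▸ hi, fun hi => ⟨S, rfl, hi⟩⟩
    simpa only [Set.mem_preimage, hiff] using hxS
  choose z hz using hz
  exact ⟨z, t, fun S i => ⟨fun hi => by simpa [hi] using hz i S,
    fun hi => by simpa [hi] using hz i S⟩⟩

theorem mainTheorem4 {G : Type*} [TopologicalSpace G] (hG : IsFiniteTopGraph G)
    {X : Type*} [MetricSpace X] [CompactSpace X] [ConnectedSpace X] [Nontrivial X]
    (hX : IsLike X G) (h : X ≃ₜ X) (hupe : HasUPE h) :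
    IsIndecomposableContinuum X := by
  refine ⟨inferInstance, inferInstance, inferInstance, ?_⟩
  rintro ⟨H, K, hH, hK, hHne, hKne, hHK⟩
  obtain ⟨x₁, hx₁⟩ := (Set.ne_univ_iff_exists_notMem K).1 hKne
  obtain ⟨x₂, hx₂⟩ := (Set.ne_univ_iff_exists_notMem H).1 hHne
  have hind : HasISPD h {Kᶜ, Hᶜ} := by
    have := hupe ![x₁, x₂] ![Kᶜ, Hᶜ] (by
      rw [Fin.forall_fin_two]
      exact ⟨⟨hK.1.isClosed.isOpen_compl, hx₁⟩, ⟨hH.1.isClosed.isOpen_compl, hx₂⟩⟩)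
    simpa [Set.pair_comm] using this
  have hKH : Kᶜ ⊆ H := fun x hx => (hHK.symm ▸ Set.mem_univ x : x ∈ H ∪ K).resolve_right hx
  obtain ⟨k, hk⟩ := exists_card_not_shattered_by_connected hG
  obtain ⟨z, t, hzt⟩ := hind.exists_shattered k
  let P : Finset (Fin k) → Set X := fun S => (h ^ t S) ⁻¹' H
  have hpow : ∀ m x, (h ^ m) x = h^[m] x := by
    intro m
    induction m with
    | zero => intro x; rfl
    | succ m ih => intro x; rw [Function.iterate_succ_apply, ← ih]; rw [pow_succ]; rfl
  have hPconn : ∀ S, IsPreconnected (P S) := fun S =>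
    (h ^ t S).isPreconnected_preimage.2 hH.2.isPreconnected
  obtain ⟨ε, hε, hsep⟩ := exists_pos_forall_isEpsMapping_notMem_image
    (fun q : Finset (Fin k) × Fin k => z q.2) (fun q => P q.1)
    (fun q => hH.1.isClosed.preimage (h ^ t q.1).continuous)
  obtain ⟨g, hg⟩ := hX ε hε
  refine hk (fun i => g (z i)) (fun S => g '' P S)
    (fun S => (hPconn S).image g hg.1.continuousOn) fun S i => ⟨fun hmem => ?_, fun hi => ?_⟩
  · by_contra hi
    refine hsep g hg (S, i) (fun hz => (hzt S i).2 hi ?_) hmem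
    rw [← hpow]
    exact hz
  · refine Set.mem_image_of_mem g ?_
    change (h ^ t S) (z i) ∈ H
    rw [hpow]
    exact hKH ((hzt S i).1 hi)
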